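/- **Proposition 2.1.** For every $d\ge 3$ there exists $\rho(d)>1$ such that the following holds. Let $g:\mathbb{R}^d\to\mathbb{R}$ be a probability density with $g(x)>0$ for all $x\in\mathbb{R}^d$, let $\{Y_x\}_{x\in\mathbb{Z}^d}$ be i.i.d. random vectors in $\mathbb{R}^d$ with density $g$, and let $\Pi=\{x+Y_x : x\in\mathbb{Z}^d\}$ be the corresponding perturbed lattice. If $$\max_{1\le i\le d}\int_{\mathbb{R}^d}\left(\frac{g(x+e_i)}{g(x)}\right)^2 g(x)\,dx<\rho(d),$$ where $e_1,\dots,e_d$ is the standard basis of $\mathbb{R}^d$ (an infinite integral violates the condition), then $\Pi$ is deletion tolerant. That is, for every $\mathbb{R}^d$-valued random variable $Z$, defined on the same probability space as $\{Y_x\}$, with $Z\in\Pi$ almost surely, the law of the point process $\Pi\setminus\{Z\}$ is absolutely continuous with respect to the law of $\Pi$. Here laws of point processes are taken on the space of point configurations in $\mathbb{R}^d$ with the $\sigma$-algebra generated by the numbers of points in Borel sets. -/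

import Mathlib

open MeasureTheory ProbabilityTheory

/-- A configuration of points in `E`: a set of points. -/
@[ext]
structure PointConfig (E : Type*) where
  /-- The points of the configuration. -/
  points : Set E

namespace PointConfig

variable {E : Type*}

/-- The number of points of a configuration in the set `B`. -/
noncomputable def count (B : Set E) (s : PointConfig E) : ℕ∞ :=
  (s.points ∩ B).encard

/-- The usual σ-algebra on point configurations, generated by the numbers of points in
measurable sets. -/
noncomputable instance [MeasurableSpace E] : MeasurableSpace (PointConfig E) :=
  ⨆ B : {B : Set E // MeasurableSet B}, MeasurableSpace.comap (count (B : Set E)) inferInstance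

/-- The configuration with the point `z` removed. -/
def erase (s : PointConfig E) (z : E) : PointConfig E :=
  ⟨s.points \ {z}⟩

end PointConfig

/-- `X` is absolutely continuous with respect to `X'`, i.e. the law of `X` is absolutely
continuous with respect to the law of `X'`. (Measurability is part of the claim, because
`Measure.map` is zero by convention for functions that are not a.e. measurable.) -/
def LawAbsolutelyContinuous {Ω S : Type*} [MeasurableSpace Ω] [MeasurableSpace S]
    (P : Measure Ω) (X X' : Ω → S) : Prop :=
  AEMeasurable X P ∧ AEMeasurable X' P ∧ (P.map X).AbsolutelyContinuous (P.map X')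

/-- `Z` is a `Π`-point: a random variable that almost surely is one of the points of `Π`. -/
def IsPointOf {Ω E : Type*} [MeasurableSpace Ω] [MeasurableSpace E]
    (P : Measure Ω) (Z : Ω → E) (Pi : Ω → PointConfig E) : Prop :=
  AEMeasurable Z P ∧ ∀ᵐ ω ∂P, Z ω ∈ (Pi ω).points

/-- The random configuration `Π` is a point process that is deletion tolerant: for every
`Π`-point `Z`, the point process `Π \ Z` is absolutely continuous with respect to `Π`. -/
def DeletionTolerant {Ω E : Type*} [MeasurableSpace Ω] [MeasurableSpace E]
    (P : Measure Ω) (Pi : Ω → PointConfig E) : Prop :=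
  AEMeasurable Pi P ∧
    ∀ Z : Ω → E, IsPointOf P Z Pi →
      LawAbsolutelyContinuous P (fun ω => (Pi ω).erase (Z ω)) Pi

/-- The perturbed lattice `{x + Y_x : x ∈ ℤ^d}`. -/
def perturbedLattice {d : ℕ} {Ω : Type*} (Y : (Fin d → ℤ) → Ω → (Fin d → ℝ)) (ω : Ω) :
    PointConfig (Fin d → ℝ) :=
  ⟨Set.range fun x : Fin d → ℤ => (fun i => (x i : ℝ)) + Y x ω⟩

/-- The integral `∫ (g (x + e_i) / g x)² g x dx` over `ℝ^d`, with values in `[0, ∞]`, where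
`e_i` is the `i`-th standard basis vector. -/
noncomputable def shiftRatioSecondMoment {d : ℕ} (g : (Fin d → ℝ) → ℝ) (i : Fin d) : ENNReal :=
  ∫⁻ x : Fin d → ℝ, ENNReal.ofReal ((g (x + Pi.single i 1) / g x) ^ 2 * g x)

open MeasureTheory ProbabilityTheory
open scoped ENNReal symmDiff

/-! The loss of the point labelled `x` can be hidden by sliding: along an infinite oriented path
from `x`, every vertex takes over the perturbed point of its successor. The remaining configuration
is then a perturbed lattice with altered perturbations (`perturbedLattice_slide`). For one fixed
path their law is a product with density ratio g(z + e_i) / g(z) at each vertex of the path, in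
general singular to the original law; so the path is random, independent of the perturbations.

On finitely many coordinates, the second moment of the mixed density averages, over two independent
paths, a product to which only common vertices contribute, each at most ρ. If ρ to the number of
common vertices has bounded mean, absolute continuity follows (`absolutelyContinuous_of_mixture`).

The path must therefore have exponential intersection tails. Independent steps fail in dimension
three, since k-step hitting probabilities are then of order 1/k. The walk used here has correlated
steps: at scale j, each block of times, of length about 8^j, uses two uniform choices among 4^j
values as the numbers of its steps in two directions. A longer window contains a whole block, so
hitting probabilities are at most 16^(-j), of order k^(-4/3). Their summability gives the tails for
ρ close to 1 (`lintegral_prod_meeting_le`). A random `Z` is handled by a union over the countably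
many labels. -/

/-! ### Measurability of random configurations. -/

theorem PointConfig.measurable_iff {Ω E : Type*} [MeasurableSpace Ω] [MeasurableSpace E]
    {s : Ω → PointConfig E} :
    Measurable s ↔ ∀ B : Set E, MeasurableSet B → Measurable fun ω => (s ω).count B := by
  constructor
  · intro h B hB
    have : Measurable (PointConfig.count B) :=
      (comap_measurable (PointConfig.count B)).mono
        (le_iSup (fun B : {B : Set E // MeasurableSet B} =>
          MeasurableSpace.comap (PointConfig.count (B : Set E)) inferInstance) ⟨B, hB⟩) le_rfl
    exact this.comp h
  · intro h
    refine Measurable.of_le_map (iSup_le fun B => ?_)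
    rw [MeasurableSpace.comap_le_iff_le_map]
    exact (h B.1 B.2).le_map

/-- The configuration of the points `f x` over a random set of labels is measurable. -/
theorem PointConfig.measurable_of_labels {Ω ι E : Type*} [MeasurableSpace Ω] [Countable ι]
    [MeasurableSpace E] [MeasurableEq E] {f : ι → Ω → E} (hf : ∀ x, Measurable (f x))
    {D : ι → Set Ω} (hD : ∀ x, MeasurableSet (D x)) :
    Measurable fun ω => (⟨{z | ∃ x, ω ∈ D x ∧ f x ω = z}⟩ : PointConfig E) := by
  classical
  rw [PointConfig.measurable_iff]
  intro B hB
  obtain ⟨e, he⟩ := Countable.exists_injective_nat ι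
  -- Different labels may give the same point, so each point is counted through its label of least
  -- code.
  let S : Ω → Set ι := fun ω =>
    {x | ω ∈ D x ∧ f x ω ∈ B ∧ ∀ y, e y < e x → ω ∈ D y → f y ω ≠ f x ω}
  have hS : Measurable S := by
    rw [measurable_set_iff]
    intro x
    refine measurableSet_setOfPred.1 ?_
    refine (hD x).inter ((hf x hB).inter ?_)
    have : {ω | ∀ y, e y < e x → ω ∈ D y → f y ω ≠ f x ω} =
        ⋂ y, ⋂ (_ : e y < e x), (D y)ᶜ ∪ {ω | f y ω = f x ω}ᶜ := by
      ext ω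
      simp [imp_iff_not_or]
    change MeasurableSet {ω | ∀ y, e y < e x → ω ∈ D y → f y ω ≠ f x ω}
    rw [this]
    exact MeasurableSet.iInter fun y => MeasurableSet.iInter fun _ =>
      (hD y).compl.union (measurableSet_eq_fun (hf y) (hf x)).compl
  have hcount : (fun ω => PointConfig.count B
      (⟨{z | ∃ x, ω ∈ D x ∧ f x ω = z}⟩ : PointConfig E)) = fun ω => (S ω).encard := by
    funext ω
    have hinj : Set.InjOn (fun x => f x ω) (S ω) := by
      intro x hx y hy hxy
      by_contra hne
      rcases lt_or_gt_of_ne (fun h => hne (he h)) with h | h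
      · exact hy.2.2 x h hx.1 hxy
      · exact hx.2.2 y h hy.1 hxy.symm
    rw [← hinj.encard_image]
    unfold PointConfig.count
    congr 1
    ext z
    constructor
    · rintro ⟨⟨x, hx, rfl⟩, hz⟩
      obtain ⟨y, ⟨hy1, hy2⟩, hymin⟩ := WellFounded.has_min (measure e).wf
        {y | ω ∈ D y ∧ f y ω = f x ω} ⟨x, hx, rfl⟩
      refine ⟨y, ⟨hy1, by rwa [hy2], fun w hw hwD hwy => ?_⟩, hy2⟩
      exact hymin w ⟨hwD, hwy.trans hy2⟩ hw
    · rintro ⟨x, hx, rfl⟩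
      exact ⟨⟨x, hx.1, rfl⟩, hx.2.1⟩
  rw [hcount]
  exact measurable_encard.comp hS

/-! ### Absolute continuity of mixtures of product measures. -/

/-- A measure which is bounded on a generating algebra by `K * P + c / K` for every `K > 0` is
absolutely continuous with respect to `P`. -/
theorem absolutelyContinuous_of_le_mul_add_div {X : Type*} {mX : MeasurableSpace X}
    {Q P : Measure X} [IsFiniteMeasure Q] [IsFiniteMeasure P] {𝒜 : Set (Set X)}
    (h𝒜 : IsSetAlgebra 𝒜) (hgen : mX = MeasurableSpace.generateFrom 𝒜) {c : ℝ≥0∞} (hc : c ≠ ∞)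
    (h : ∀ K : ℝ≥0∞, K ≠ 0 → K ≠ ∞ → ∀ A ∈ 𝒜, Q A ≤ K * P A + c / K) : Q ≪ P := by
  refine Measure.AbsolutelyContinuous.mk fun A hA hPA => ?_
  have key : ∀ K : ℝ≥0∞, K ≠ 0 → K ≠ ∞ → Q A ≤ c / K := by
    intro K hK0 hK
    -- Approximate the null set `A` by a set of the algebra, for `P` and `Q` simultaneously.
    have aux : ∀ ε : ℝ≥0∞, 0 < ε → Q A ≤ (1 + K) * ε + c / K := by
      intro ε hε
      obtain ⟨t, ht, hlt⟩ := exists_measure_symmDiff_lt_of_generateFrom_isSetRing (μ := P + Q)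
        h𝒜.isSetRing ⟨{Set.univ}, Set.countable_singleton _,
          by simpa using h𝒜.univ_mem, by simp⟩ hgen hA hε
      rw [Measure.add_apply] at hlt
      have hQ : Q A ≤ Q t + ε := by
        calc Q A ≤ Q (t ∪ t ∆ A) := measure_mono fun x hx => by
              by_cases hxt : x ∈ t
              · exact Or.inl hxt
              · exact Or.inr (Or.inr ⟨hx, hxt⟩)
          _ ≤ Q t + Q (t ∆ A) := measure_union_le _ _
          _ ≤ Q t + ε := by gcongr; exact (le_add_self.trans hlt.le)
      have hP : P t ≤ ε := by
        calc P t ≤ P (A ∪ t ∆ A) := measure_mono fun x hx => by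
              by_cases hxt : x ∈ A
              · exact Or.inl hxt
              · exact Or.inr (Or.inl ⟨hx, hxt⟩)
          _ ≤ P A + P (t ∆ A) := measure_union_le _ _
          _ ≤ ε := by rw [hPA, zero_add]; exact (le_self_add.trans hlt.le)
      calc Q A ≤ Q t + ε := hQ
        _ ≤ (K * P t + c / K) + ε := by gcongr; exact h K hK0 hK t ht
        _ ≤ (K * ε + c / K) + ε := by gcongr
        _ = (1 + K) * ε + c / K := by ring
    refine ENNReal.le_of_forall_pos_le_add fun δ hδ _ => ?_
    have h1K : 1 + K ≠ ∞ := by simp [hK]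
    have h1K0 : 1 + K ≠ 0 := by simp
    have := aux (δ / (1 + K)) (ENNReal.div_pos (by simpa using hδ.ne') h1K)
    rwa [ENNReal.mul_div_cancel h1K0 h1K, add_comm] at this
  by_contra hne
  have hK := ENNReal.div_ne_top (ENNReal.add_ne_top.2 ⟨hc, ENNReal.one_ne_top⟩) hne
  have h1 := key ((c + 1) / Q A) (ENNReal.div_pos (by simp : c + 1 ≠ 0) (measure_ne_top _ _)).ne' hK
  rw [ENNReal.le_div_iff_mul_le (Or.inl (ENNReal.div_pos (by simp : c + 1 ≠ 0) (measure_ne_top _ _)).ne') (Or.inr hc),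
    ENNReal.mul_div_cancel hne (measure_ne_top _ _)] at h1
  exact absurd (ENNReal.lt_add_right hc one_ne_zero) (not_lt.2 h1)

theorem lintegral_infinitePi_prod {ι : Type*} {X : ι → Type*} [∀ i, MeasurableSpace (X i)]
    (μ : ∀ i, Measure (X i)) [∀ i, IsProbabilityMeasure (μ i)] (s : Finset ι)
    {h : ∀ i, X i → ℝ≥0∞} (hh : ∀ i, Measurable (h i)) :
    ∫⁻ y, ∏ i ∈ s, h i (y i) ∂(Measure.infinitePi μ) = ∏ i ∈ s, ∫⁻ z, h i z ∂(μ i) := by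
  refine (lintegral_prod_eq_prod_lintegral_of_indepFun s (fun i (y : ∀ i, X i) => h i (y i))
    (iIndepFun_infinitePi hh) (fun i => (hh i).comp (measurable_pi_apply i))).trans ?_
  refine Finset.prod_congr rfl fun i _ => ?_
  exact (measurePreserving_eval_infinitePi μ i).lintegral_comp (hh i)

/-- On cylinders over `F`, an infinite product of measures with densities `r i` has density
`∏ i ∈ F, r i`. -/
theorem infinitePi_withDensity_cylinder {ι : Type*} {X : ι → Type*} [∀ i, MeasurableSpace (X i)]
    (μ : ∀ i, Measure (X i)) [∀ i, IsProbabilityMeasure (μ i)]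
    {r : ∀ i, X i → ℝ≥0∞} (hr : ∀ i, Measurable (r i))
    [∀ i, IsProbabilityMeasure ((μ i).withDensity (r i))] (F : Finset ι)
    {S : Set (∀ i : F, X i)} (hS : MeasurableSet S) :
    Measure.infinitePi (fun i => (μ i).withDensity (r i)) (cylinder F S) =
      ∫⁻ y in cylinder F S, ∏ i ∈ F, r i (y i) ∂(Measure.infinitePi μ) := by
  classical
  -- Replacing the densities off `F` by 1 changes nothing on cylinders over `F`, and the result has
  -- a genuine density even for infinite `ι`.
  let r' : ∀ i, X i → ℝ≥0∞ := fun i => if i ∈ F then r i else 1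
  have hr' : ∀ i, Measurable (r' i) := fun i => by
    by_cases hi : i ∈ F
    · simpa [r', hi] using hr i
    · simpa [r', hi] using measurable_one
  have hp : ∀ i, IsProbabilityMeasure ((μ i).withDensity (r' i)) := fun i => by
    by_cases hi : i ∈ F
    · simp only [r', hi, if_true]; infer_instance
    · simp only [r', hi, if_false, withDensity_one]; infer_instance
  have key : (Measure.infinitePi μ).withDensity (fun y => ∏ i ∈ F, r i (y i)) =
      Measure.infinitePi (fun i => (μ i).withDensity (r' i)) := by
    refine Measure.eq_infinitePi _ fun s t ht => ?_
    have hms : MeasurableSet ((s : Set ι).pi t) := .pi s.countable_toSet fun _ _ => ht _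
    rw [withDensity_apply _ hms, ← lintegral_indicator hms]
    have e1 : ∀ y : ∀ i, X i, ((s : Set ι).pi t).indicator (fun y => ∏ i ∈ F, r i (y i)) y =
        ∏ i ∈ s ∪ F, (if i ∈ s then (t i).indicator 1 (y i) else 1) * r' i (y i) := by
      intro y
      rw [Finset.prod_mul_distrib]
      have e2 : ∏ i ∈ s ∪ F, r' i (y i) = ∏ i ∈ F, r i (y i) := by
        rw [← Finset.prod_subset Finset.subset_union_right]
        · exact Finset.prod_congr rfl fun i hi => by simp [r', hi]
        · intro i _ hi; simp [r', hi]
      have e3 : ∏ i ∈ s ∪ F, (if i ∈ s then (t i).indicator (1 : X i → ℝ≥0∞) (y i) else 1) =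
          ∏ i ∈ s, (t i).indicator (1 : X i → ℝ≥0∞) (y i) := by
        rw [← Finset.prod_subset Finset.subset_union_left]
        · exact Finset.prod_congr rfl fun i hi => by simp [hi]
        · intro i _ hi; simp [hi]
      rw [e2, e3]
      by_cases hy : y ∈ (s : Set ι).pi t
      · rw [Set.indicator_of_mem hy, Finset.prod_eq_one (s := s), one_mul]
        intro i hi; simp [hy i hi]
      · rw [Set.indicator_of_notMem hy]
        simp only [Set.mem_pi, not_forall] at hy
        obtain ⟨i, hi, hyi⟩ := hy
        rw [Finset.prod_eq_zero hi (by simp [hyi]), zero_mul]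
    simp_rw [e1]
    rw [lintegral_infinitePi_prod μ (s ∪ F)
      (h := fun i z => (if i ∈ s then (t i).indicator 1 z else 1) * r' i z)]
    · rw [← Finset.prod_subset (Finset.subset_union_left : s ⊆ s ∪ F)]
      · refine Finset.prod_congr rfl fun i hi => ?_
        rw [withDensity_apply _ (ht i), ← lintegral_indicator (ht i)]
        refine lintegral_congr fun z => ?_
        by_cases hz : z ∈ t i <;> simp [hi, hz]
      · intro i _ hi
        simp only [hi, if_false, one_mul]
        rw [← setLIntegral_univ, ← withDensity_apply _ .univ]
        exact measure_univ
    · intro i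
      refine Measurable.mul ?_ (hr' i)
      by_cases hi : i ∈ s
      · simpa [hi] using measurable_one.indicator (ht i)
      · simp [hi]
  have hcyl : MeasurableSet (cylinder F S) := .cylinder F hS
  rw [← withDensity_apply _ hcyl, key, Measure.infinitePi_cylinder _ hS,
    Measure.infinitePi_cylinder _ hS]
  congr 2
  funext i
  simp [r']

/-- A mixture of infinite products of measures with densities `r θ i` with respect to `ν` is
absolutely continuous with respect to the infinite power of `ν` if the second moments of the
mixed densities on finite sets of coordinates are bounded. -/
theorem absolutelyContinuous_of_mixture {ι E Θ : Type*} [MeasurableSpace E] [MeasurableSpace Θ]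
    (ν : Measure E) [IsProbabilityMeasure ν] (μ : Measure Θ) [IsProbabilityMeasure μ]
    {r : Θ → ι → E → ℝ≥0∞} (hr : ∀ i, Measurable fun p : Θ × E => r p.1 i p.2)
    (h1 : ∀ θ i, ∫⁻ z, r θ i z ∂ν = 1) {Q : Measure (ι → E)} [IsFiniteMeasure Q]
    (hQ : ∀ A, MeasurableSet A →
      Q A = ∫⁻ θ, Measure.infinitePi (fun i => ν.withDensity (r θ i)) A ∂μ)
    {c : ℝ≥0∞} (hc : c ≠ ∞)
    (hb : ∀ F : Finset ι, ∫⁻ θ, ∫⁻ θ', ∏ i ∈ F, ∫⁻ z, r θ i z * r θ' i z ∂ν ∂μ ∂μ ≤ c) :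
    Q ≪ Measure.infinitePi fun _ => ν := by
  classical
  have hprob : ∀ θ i, IsProbabilityMeasure (ν.withDensity (r θ i)) := fun θ i =>
    ⟨by rw [withDensity_apply _ .univ, setLIntegral_univ, h1]⟩
  have hrθ : ∀ θ i, Measurable (r θ i) := fun θ i => (hr i).comp measurable_prodMk_left
  refine absolutelyContinuous_of_le_mul_add_div (𝒜 := measurableCylinders fun _ : ι => E)
    isSetAlgebra_measurableCylinders generateFrom_measurableCylinders.symm hc
    fun K hK0 hK A hA => ?_
  obtain ⟨F, S, hS, rfl⟩ := (mem_measurableCylinders _).1 hA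
  have hcyl : MeasurableSet (cylinder (α := fun _ : ι => E) F S) := .cylinder F hS
  have hprod : Measurable fun p : Θ × (ι → E) => ∏ i ∈ F, r p.1 i (p.2 i) :=
    Finset.measurable_prod _ fun i _ =>
      (hr i).comp (measurable_fst.prodMk ((measurable_pi_apply i).comp measurable_snd))
  set P := Measure.infinitePi fun _ : ι => ν with hP
  let f : (ι → E) → ℝ≥0∞ := fun y => ∫⁻ θ, ∏ i ∈ F, r θ i (y i) ∂μ
  have hf : Measurable f := hprod.lintegral_prod_left'
  have hQA : Q (cylinder F S) = ∫⁻ y in cylinder F S, f y ∂P := by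
    rw [hQ _ hcyl]
    simp_rw [fun θ => infinitePi_withDensity_cylinder (fun _ : ι => ν) (hrθ θ) F hS]
    exact lintegral_lintegral_swap hprod.aemeasurable
  -- The square of a mixture is a double integral over two independent parameters; by Tonelli the
  -- coordinates are integrated first.
  have hsq : ∫⁻ y, f y * f y ∂P ≤ c := by
    have e1 : ∀ y, f y * f y =
        ∫⁻ θ, ∫⁻ θ', ∏ i ∈ F, (r θ i (y i) * r θ' i (y i)) ∂μ ∂μ := by
      intro y
      have hm : Measurable fun θ => ∏ i ∈ F, r θ i (y i) := hprod.comp measurable_prodMk_right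
      simp_rw [Finset.prod_mul_distrib]
      simp_rw [lintegral_const_mul _ hm, lintegral_mul_const _ hm]
      rfl
    have hm3 : Measurable fun p : (ι → E) × Θ × Θ =>
        ∏ i ∈ F, (r p.2.1 i (p.1 i) * r p.2.2 i (p.1 i)) := by
      refine Finset.measurable_prod _ fun i _ => Measurable.mul ?_ ?_
      · exact (hr i).comp (by fun_prop : Measurable fun p : (ι → E) × Θ × Θ => (p.2.1, p.1 i))
      · exact (hr i).comp (by fun_prop : Measurable fun p : (ι → E) × Θ × Θ => (p.2.2, p.1 i))
    calc ∫⁻ y, f y * f y ∂P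
        = ∫⁻ y, ∫⁻ q : Θ × Θ, ∏ i ∈ F, (r q.1 i (y i) * r q.2 i (y i)) ∂(μ.prod μ) ∂P := by
          refine lintegral_congr fun y => ?_
          rw [e1]
          exact (lintegral_prod _ (hm3.comp measurable_prodMk_left).aemeasurable).symm
      _ = ∫⁻ q : Θ × Θ, ∫⁻ y, ∏ i ∈ F, (r q.1 i (y i) * r q.2 i (y i)) ∂P ∂(μ.prod μ) :=
          lintegral_lintegral_swap hm3.aemeasurable
      _ = ∫⁻ q : Θ × Θ, ∏ i ∈ F, ∫⁻ z, r q.1 i z * r q.2 i z ∂ν ∂(μ.prod μ) := by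
          refine lintegral_congr fun q => ?_
          exact lintegral_infinitePi_prod (fun _ : ι => ν) F
            (fun i => (hrθ q.1 i).mul (hrθ q.2 i))
      _ = ∫⁻ θ, ∫⁻ θ', ∏ i ∈ F, ∫⁻ z, r θ i z * r θ' i z ∂ν ∂μ ∂μ := by
          refine lintegral_prod _ (Measurable.aemeasurable ?_)
          refine Finset.measurable_prod _ fun i _ => Measurable.lintegral_prod_right'
            (f := fun p : (Θ × Θ) × E => r p.1.1 i p.2 * r p.1.2 i p.2) ?_
          exact ((hr i).comp (by fun_prop : Measurable fun p : (Θ × Θ) × E => (p.1.1, p.2))).mul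
            ((hr i).comp (by fun_prop : Measurable fun p : (Θ × Θ) × E => (p.1.2, p.2)))
      _ ≤ c := hb F
  -- Truncation at `K`: this turns the second moment into the bound required by the criterion.
  have hle : ∀ y, f y ≤ K + f y * f y / K := by
    intro y
    rcases le_total (f y) K with h | h
    · exact h.trans le_self_add
    · refine le_trans ?_ le_add_self
      rw [ENNReal.le_div_iff_mul_le (Or.inl hK0) (Or.inl hK)]
      gcongr
  calc Q (cylinder F S) = ∫⁻ y in cylinder F S, f y ∂P := hQA
    _ ≤ ∫⁻ y in cylinder F S, (K + f y * f y / K) ∂P := lintegral_mono hle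
    _ = K * P (cylinder F S) + ∫⁻ y in cylinder F S, f y * f y / K ∂P := by
        rw [lintegral_add_left measurable_const, setLIntegral_const]
    _ ≤ K * P (cylinder F S) + ∫⁻ y, f y * f y / K ∂P := by
        gcongr; exact Measure.restrict_le_self
    _ = K * P (cylinder F S) + (∫⁻ y, f y * f y ∂P) / K := by
        simp_rw [div_eq_mul_inv]
        rw [lintegral_mul_const _ (by fun_prop : Measurable fun y => f y * f y)]
    _ ≤ K * P (cylinder F S) + c / K := by gcongr

/-! ### Exponential moments of the number of meetings. -/

/-- If a process hits each point after `k` further steps with conditional probability at most `q k`,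
with `q` summable, then the number of its meetings with a fixed trajectory has exponential
moments. -/
theorem lintegral_prod_meeting_le {Θ V : Type*} [MeasurableSpace Θ] (μ : Measure Θ)
    [IsProbabilityMeasure μ] [MeasurableSpace V] [MeasurableSingletonClass V] [DecidableEq V]
    {X : ℕ → Θ → V} (hX : ∀ n, Measurable (X n)) {q : ℕ → ℝ≥0∞}
    (hq : ∀ l k, 0 < k → ∀ x, ∀ W : Θ → ℝ≥0∞, Measurable W →
      (∀ θ θ', (∀ j ≤ l, X j θ = X j θ') → W θ = W θ') →
      ∫⁻ θ, {θ | X (l + k) θ = x}.indicator W θ ∂μ ≤ q k * ∫⁻ θ, W θ ∂μ)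
    (z : ℕ → V) {t : ℝ≥0∞} (ht : t ≠ ∞) (htq : t * ∑' k, q k ≤ 1 / 2) (n : ℕ) :
    ∫⁻ θ, ∏ i ∈ Finset.range n, (if X i θ = z i then 1 + t else 1) ∂μ ≤
      1 + t * (2 * (1 + ∑' k, q k)) := by
  set c := ∑' k, q k with hc
  let W : ℕ → Θ → ℝ≥0∞ := fun n θ => ∏ i ∈ Finset.range n, (if X i θ = z i then 1 + t else 1)
  let M : ℕ → Set Θ := fun i => {θ | X i θ = z i}
  have hM : ∀ i, MeasurableSet (M i) := fun i => hX i (measurableSet_singleton _)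
  have hW : ∀ n, Measurable (W n) := fun n =>
    Finset.measurable_prod _ fun i _ => Measurable.ite (hM i) measurable_const measurable_const
  have hWhist : ∀ l, ∀ θ θ', (∀ j ≤ l, X j θ = X j θ') →
      (M l).indicator (W l) θ = (M l).indicator (W l) θ' := by
    intro l θ θ' h
    have h1 : W l θ = W l θ' := Finset.prod_congr rfl fun i hi => by
      rw [h i (Finset.mem_range.1 hi).le]
    have h2 : θ ∈ M l ↔ θ' ∈ M l := by simp [M, h l le_rfl]
    by_cases h3 : θ ∈ M l
    · rw [Set.indicator_of_mem h3, Set.indicator_of_mem (h2.1 h3), h1]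
    · rw [Set.indicator_of_notMem h3, Set.indicator_of_notMem (fun h => h3 (h2.2 h))]
  let a : ℕ → ℝ≥0∞ := fun i => ∫⁻ θ, (M i).indicator (W i) θ ∂μ
  -- Telescoping: a meeting at time `i` increases the weight by `t` times the weight so far.
  have hWsum : ∀ n θ, W n θ = 1 + t * ∑ i ∈ Finset.range n, (M i).indicator (W i) θ := by
    intro n θ
    induction n with
    | zero => simp [W]
    | succ n ih =>
      have : W (n + 1) θ = W n θ + t * (M n).indicator (W n) θ := by
        simp only [W, Finset.prod_range_succ]
        by_cases h : X n θ = z n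
        · rw [if_pos h, Set.indicator_of_mem (show θ ∈ M n from h)]; ring
        · rw [if_neg h, Set.indicator_of_notMem (show θ ∉ M n from h)]; ring
      rw [this, Finset.sum_range_succ, ih]
      ring
  have hindm : ∀ i, Measurable ((M i).indicator (W i)) := fun i => (hW i).indicator (hM i)
  have hint : ∀ n, ∫⁻ θ, W n θ ∂μ = 1 + t * ∑ i ∈ Finset.range n, a i := by
    intro n
    simp_rw [hWsum n]
    rw [lintegral_add_left measurable_const, lintegral_const_mul _ (by fun_prop),
      lintegral_finsetSum _ fun i _ => hindm i]
    simp [a]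
  -- A renewal inequality: expand the weight over the earlier meetings `l`, then bound the return
  -- after `i - l` steps. Time 0 is separate because `hq` needs `0 < k`.
  have ha : ∀ i, a i ≤ (if i = 0 then 1 else 0) + q i +
      t * ∑ l ∈ Finset.range i, q (i - l) * a l := by
    intro i
    rcases Nat.eq_zero_or_pos i with rfl | hi
    · have : a 0 ≤ 1 := by
        calc a 0 ≤ ∫⁻ _, 1 ∂μ := lintegral_mono fun θ => by
              refine (Set.indicator_le_self _ _ _).trans ?_
              simp [W]
          _ = 1 := by simp
      simpa using this.trans le_self_add
    · rw [if_neg hi.ne', zero_add]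
      have e1 : ∀ θ, (M i).indicator (W i) θ = (M i).indicator 1 θ +
          t * ∑ l ∈ Finset.range i, (M i).indicator ((M l).indicator (W l)) θ := by
        intro θ
        by_cases h : θ ∈ M i
        · simp only [Set.indicator_of_mem h]
          exact hWsum i θ
        · simp [Set.indicator_of_notMem h]
      have hm2 : ∀ l, Measurable ((M i).indicator ((M l).indicator (W l))) := fun l =>
        (hindm l).indicator (hM i)
      calc a i = ∫⁻ θ, (M i).indicator 1 θ ∂μ +
            t * ∑ l ∈ Finset.range i, ∫⁻ θ, (M i).indicator ((M l).indicator (W l)) θ ∂μ := by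
            simp only [a]
            simp_rw [e1]
            rw [lintegral_add_left (measurable_one.indicator (hM i)),
              lintegral_const_mul _ (by fun_prop), lintegral_finsetSum _ fun l _ => hm2 l]
        _ ≤ q i + t * ∑ l ∈ Finset.range i, q (i - l) * a l := by
            gcongr with l hl
            · have := hq 0 i hi (z i) 1 measurable_one (fun _ _ _ => rfl)
              simpa [M] using this
            · have hli := Finset.mem_range.1 hl
              have := hq l (i - l) (by omega) (z i) _ (hindm l) (hWhist l)
              rwa [show l + (i - l) = i by omega] at this
  set S := ∑ i ∈ Finset.range n, a i with hS
  -- Finiteness is what later allows `S / 2` to be cancelled.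
  have hafin : ∀ i, a i ≠ ∞ := by
    intro i
    have : a i ≤ (1 + t) ^ i := by
      calc a i ≤ ∫⁻ _, (1 + t) ^ i ∂μ := lintegral_mono fun θ => by
            refine (Set.indicator_le_self _ _ _).trans ?_
            calc W i θ ≤ ∏ _j ∈ Finset.range i, (1 + t) :=
                  Finset.prod_le_prod' fun j _ => by split_ifs <;> simp
              _ = (1 + t) ^ i := by simp
        _ = (1 + t) ^ i := by simp
    exact ne_top_of_le_ne_top (ENNReal.pow_ne_top (by simp [ht])) this
  have hSfin : S ≠ ∞ := (ENNReal.sum_lt_top.2 fun i _ => (hafin i).lt_top).ne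
  have hconv : ∑ i ∈ Finset.range n, ∑ l ∈ Finset.range i, q (i - l) * a l ≤ c * S := by
    calc ∑ i ∈ Finset.range n, ∑ l ∈ Finset.range i, q (i - l) * a l
        = ∑ l ∈ Finset.range n, ∑ i ∈ (Finset.range n).filter (fun i => l < i),
            q (i - l) * a l := by
          refine Finset.sum_comm' fun i l => ?_
          simp only [Finset.mem_range, Finset.mem_filter]
          omega
      _ ≤ ∑ l ∈ Finset.range n, c * a l := by
          refine Finset.sum_le_sum fun l _ => ?_
          rw [← Finset.sum_mul]
          gcongr
          rw [← Finset.sum_image (f := q) (g := fun i => i - l)]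
          · exact ENNReal.sum_le_tsum _
          · intro i hi j hj hij
            simp only [Finset.coe_filter, Finset.mem_range, Set.mem_ofPred_eq] at hi hj hij
            omega
      _ = c * S := by rw [Finset.mul_sum]
  have hSle : S ≤ (1 + c) + S / 2 := by
    calc S ≤ ∑ i ∈ Finset.range n, ((if i = 0 then 1 else 0) + q i +
          t * ∑ l ∈ Finset.range i, q (i - l) * a l) := Finset.sum_le_sum fun i _ => ha i
      _ = ∑ i ∈ Finset.range n, (if i = 0 then 1 else 0) + ∑ i ∈ Finset.range n, q i +
          t * ∑ i ∈ Finset.range n, ∑ l ∈ Finset.range i, q (i - l) * a l := by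
          rw [Finset.sum_add_distrib, Finset.sum_add_distrib, Finset.mul_sum]
      _ ≤ 1 + c + t * (c * S) := by
          gcongr
          · rw [Finset.sum_ite_eq']; split_ifs <;> simp
          · exact ENNReal.sum_le_tsum _
      _ = 1 + c + (t * c) * S := by ring
      _ ≤ 1 + c + (1 / 2) * S := by gcongr
      _ = (1 + c) + S / 2 := by rw [one_div, mul_comm, div_eq_mul_inv]
  have hS2 : S ≤ 2 * (1 + c) := by
    have h2 : S / 2 ≤ 1 + c := by
      have h3 : S / 2 + S / 2 ≤ (1 + c) + S / 2 := by rwa [ENNReal.add_halves]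
      exact (ENNReal.add_le_add_iff_right (ENNReal.div_ne_top hSfin (by simp))).1 h3
    calc S = 2 * (S / 2) := by rw [ENNReal.mul_div_cancel (by simp) (by simp)]
      _ ≤ 2 * (1 + c) := by gcongr
  calc ∫⁻ θ, W n θ ∂μ = 1 + t * S := hint n
    _ ≤ 1 + t * (2 * (1 + c)) := by gcongr

/-! ### The oriented walk and its hitting probabilities. -/

namespace OrientedWalk

/-- The random choices behind the oriented walk: for each scale `j`, block `i` and colour, a number
in `{0, …, 4 ^ j - 1}`. -/
abbrev Choices : Type := ∀ b : ℕ × ℕ × Bool, ZMod (4 ^ b.1)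

/-- The uniform distribution on choices. -/
noncomputable def choiceMeasure : Measure Choices :=
  Measure.infinitePi fun b => (PMF.uniformOfFintype (ZMod (4 ^ b.1))).toMeasure

instance : IsProbabilityMeasure choiceMeasure := by
  unfold choiceMeasure; infer_instance

theorem map_add_uniform {G : Type*} [Fintype G] [AddGroup G] [MeasurableSpace G]
    [DiscreteMeasurableSpace G] (g : G) :
    (PMF.uniformOfFintype G).toMeasure.map (· + g) = (PMF.uniformOfFintype G).toMeasure := by
  refine Measure.ext_of_singleton fun a => ?_
  have : (· + g) ⁻¹' {a} = {a - g} := by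
    ext b; rw [Set.mem_preimage, Set.mem_singleton_iff, Set.mem_singleton_iff, eq_sub_iff_add_eq]
  rw [Measure.map_apply (measurable_of_countable _) (measurableSet_singleton _), this,
    PMF.toMeasure_apply_singleton _ _ (measurableSet_singleton _),
    PMF.toMeasure_apply_singleton _ _ (measurableSet_singleton _)]
  simp

/-- Choices live in the groups `ZMod (4 ^ j)` for the sake of this invariance: it lets one block be
resampled by translation. -/
theorem measurePreserving_add (δ : Choices) :
    MeasurePreserving (fun θ => θ + δ) choiceMeasure choiceMeasure := by
  refine ⟨by fun_prop, ?_⟩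
  have h := Measure.infinitePi_map_pi
    (μ := fun b : ℕ × ℕ × Bool => (PMF.uniformOfFintype (ZMod (4 ^ b.1))).toMeasure)
    (f := fun b z => z + δ b) (fun b => measurable_of_countable _)
  simp_rw [map_add_uniform] at h
  exact h

/-- The scale at which the step at time `t` is chosen. -/
def scale (t : ℕ) : ℕ := padicValNat 2 (t + 1)

/-- The position of `t` among the times of its scale. -/
def pos (t : ℕ) : ℕ := (t + 1) / 2 ^ scale t / 2

/-- The block of the time `t`. -/
def block (t : ℕ) : ℕ := pos t / (2 * 4 ^ scale t)

/-- The colour of the time `t`. -/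
def colour (t : ℕ) : Bool := decide (4 ^ scale t ≤ pos t % (2 * 4 ^ scale t))

/-- The position of the time `t` among the times of its colour in its block. -/
def rank (t : ℕ) : ℕ := pos t % 4 ^ scale t

/-- Times of scale j are 2^(j+1) apart and a block has 2 · 4^j of them, so it spans 4 · 8^j times.
This bounds where a block starts; `exists_time` bounds where it ends. -/
theorem block_le (t : ℕ) : 4 * 8 ^ scale t * block t ≤ t + 1 := by
  have h1 : 2 ^ scale t * ((t + 1) / 2 ^ scale t) ≤ t + 1 := Nat.mul_div_le _ _
  have h2 : 2 * pos t ≤ (t + 1) / 2 ^ scale t := Nat.mul_div_le _ _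
  have h3 : 2 * 4 ^ scale t * block t ≤ pos t := Nat.mul_div_le _ _
  calc 4 * 8 ^ scale t * block t = 2 ^ scale t * (2 * (2 * 4 ^ scale t * block t)) := by
        rw [show (8 : ℕ) = 2 * 4 by norm_num, mul_pow]; ring
    _ ≤ 2 ^ scale t * ((t + 1) / 2 ^ scale t) := by
        gcongr
        exact (Nat.mul_le_mul_left 2 h3).trans h2
    _ ≤ t + 1 := h1

/-- Each rank occurs in each block, with each colour. -/
theorem exists_time (j i : ℕ) (c : Bool) {u : ℕ} (hu : u < 4 ^ j) :
    ∃ t, t < 4 * 8 ^ j * (i + 1) ∧ scale t = j ∧ block t = i ∧ colour t = c ∧ rank t = u := by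
  -- With `r` the place inside the block and `q` the place within the scale, the time is given by t
  -- + 1 = 2^j (2q + 1).
  set r : ℕ := (if c then 4 ^ j else 0) + u with hr
  have hr2 : r < 2 * 4 ^ j := by split_ifs at hr <;> omega
  set q : ℕ := 2 * 4 ^ j * i + r with hq
  have hpos : 0 < 2 ^ j * (2 * q + 1) := by positivity
  have hscale : scale (2 ^ j * (2 * q + 1) - 1) = j := by
    unfold scale
    rw [Nat.sub_add_cancel hpos, padicValNat.mul (by positivity) (by positivity),
      padicValNat.prime_pow, padicValNat.eq_zero_of_not_dvd (by omega), add_zero]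
  have hposq : pos (2 ^ j * (2 * q + 1) - 1) = q := by
    unfold pos
    rw [hscale, Nat.sub_add_cancel hpos, Nat.mul_div_cancel_left _ (by positivity)]
    omega
  have hqmod : q % (2 * 4 ^ j) = r := by
    rw [hq, Nat.mul_add_mod, Nat.mod_eq_of_lt hr2]
  refine ⟨2 ^ j * (2 * q + 1) - 1, ?_, hscale, ?_, ?_, ?_⟩
  · have h8 : (8 : ℕ) ^ j = 2 ^ j * 4 ^ j := by rw [← mul_pow]; norm_num
    have : 2 ^ j * (2 * q + 1) ≤ 4 * 8 ^ j * (i + 1) := by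
      calc 2 ^ j * (2 * q + 1) ≤ 2 ^ j * (2 * (2 * 4 ^ j * (i + 1))) := by
            gcongr
            have : 2 * 4 ^ j * (i + 1) = 2 * 4 ^ j * i + 2 * 4 ^ j := by ring
            omega
        _ = 4 * 8 ^ j * (i + 1) := by rw [h8]; ring
    omega
  · unfold block
    rw [hscale, hposq, hq, Nat.mul_add_div (by positivity), Nat.div_eq_of_lt hr2, add_zero]
  · unfold colour
    rw [hscale, hposq, hqmod, hr]
    cases c
    · simpa using hu
    · simp
  · unfold rank
    rw [hscale, hposq, hq]
    have : 2 * 4 ^ j * i + r = 4 ^ j * (2 * i + if c then 1 else 0) + u := by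
      rw [hr]; split_ifs <;> ring
    rw [this, Nat.mul_add_mod, Nat.mod_eq_of_lt hu]

/-- Whether the walk goes in the direction of the colour at time `t`. -/
def Turns (θ : Choices) (t : ℕ) : Prop :=
  rank t < (θ (scale t, block t, colour t)).val

open Classical in
/-- The direction of the step at time `t`. -/
noncomputable def dir (θ : Choices) (t : ℕ) : Fin 3 :=
  if Turns θ t then (if colour t then 2 else 1) else 0

theorem measurable_dir (t : ℕ) : Measurable fun θ => dir θ t := by
  have : (fun θ => dir θ t) = (fun z : ZMod (4 ^ scale t) =>
      if rank t < z.val then (if colour t then (2 : Fin 3) else 1) else 0) ∘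
      fun θ : Choices => θ (scale t, block t, colour t) := by
    funext θ
    simp only [dir, Turns, Function.comp]
    congr
  rw [this]
  exact (measurable_of_countable _).comp (measurable_pi_apply _)

variable {d : ℕ}

/-- The oriented walk from `x`. -/
noncomputable def walk (hd : 3 ≤ d) (x : Fin d → ℤ) (n : ℕ) (θ : Choices) : Fin d → ℤ :=
  x - ∑ t ∈ Finset.range n, Pi.single (Fin.castLE hd (dir θ t)) 1

theorem measurable_walk (hd : 3 ≤ d) (x : Fin d → ℤ) (n : ℕ) : Measurable (walk hd x n) := by
  unfold walk
  refine measurable_const.sub (Finset.measurable_sum _ fun t _ => ?_)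
  exact (measurable_of_countable fun s : Fin 3 => (Pi.single (Fin.castLE hd s) 1 : Fin d → ℤ)).comp
    (measurable_dir t)

theorem walk_zero (hd : 3 ≤ d) (x : Fin d → ℤ) (θ : Choices) : walk hd x 0 θ = x := by
  simp [walk]

theorem walk_succ (hd : 3 ≤ d) (x : Fin d → ℤ) (n : ℕ) (θ : Choices) :
    walk hd x (n + 1) θ = walk hd x n θ - Pi.single (Fin.castLE hd (dir θ n)) 1 := by
  simp only [walk, Finset.sum_range_succ]; abel

theorem walk_congr (hd : 3 ≤ d) (x : Fin d → ℤ) {n : ℕ} {θ θ' : Choices}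
    (h : ∀ t < n, dir θ t = dir θ' t) : walk hd x n θ = walk hd x n θ' := by
  unfold walk
  rw [Finset.sum_congr rfl fun t ht => by rw [h t (Finset.mem_range.1 ht)]]

/-- The position determines the time, so two walks from `x` can share a vertex only at the same
time. -/
theorem sum_walk (hd : 3 ≤ d) (x : Fin d → ℤ) (n : ℕ) (θ : Choices) :
    ∑ i, walk hd x n θ i = ∑ i, x i - n := by
  induction n with
  | zero => simp [walk_zero]
  | succ n ih =>
    rw [walk_succ]
    simp only [Pi.sub_apply, Finset.sum_sub_distrib, ih, Finset.sum_pi_single', Nat.cast_add]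
    simp
    ring

theorem walk_apply (hd : 3 ≤ d) (x : Fin d → ℤ) (n : ℕ) (θ : Choices) (s : Fin 3) :
    walk hd x n θ (Fin.castLE hd s) =
      x (Fin.castLE hd s) - ∑ t ∈ Finset.range n, if dir θ t = s then 1 else 0 := by
  simp only [walk, Pi.sub_apply, Finset.sum_apply, Pi.single_apply]
  simp only [Fin.castLE_inj, eq_comm]

theorem dir_eq_iff (θ : Choices) (t : ℕ) (c : Bool) :
    dir θ t = (if c then 2 else 1) ↔ Turns θ t ∧ colour t = c := by
  unfold dir
  by_cases h : Turns θ t <;> cases c <;> cases h' : colour t <;> simp [h]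

/-- The choices in a block are determined by the position of the walk after the block and the
choices in the other blocks. -/
theorem val_le_of_walk_eq (hd : 3 ≤ d) (x : Fin d → ℤ) {j i n : ℕ} (hn : 4 * 8 ^ j * (i + 1) ≤ n)
    {θ θ' : Choices} (hθ : ∀ b : ℕ × ℕ × Bool, ¬(b.1 = j ∧ b.2.1 = i) → θ b = θ' b)
    (h : walk hd x n θ = walk hd x n θ') (c : Bool) :
    (θ (j, i, c)).val ≤ (θ' (j, i, c)).val := by
  by_contra! hlt
  have h1 := congrFun h (Fin.castLE hd (if c then 2 else 1))
  rw [walk_apply, walk_apply, sub_right_inj] at h1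
  -- Raising the threshold only adds steps in the direction of `c`, and the time whose rank equals
  -- the smaller threshold adds at least one.
  refine absurd h1 (ne_of_gt (Finset.sum_lt_sum (fun t _ => ?_) ?_))
  · have himp : dir θ' t = (if c then 2 else 1) → dir θ t = (if c then 2 else 1) := by
      rw [dir_eq_iff, dir_eq_iff]
      rintro ⟨ht, hc⟩
      refine ⟨?_, hc⟩
      unfold Turns at ht ⊢
      by_cases hb : scale t = j ∧ block t = i
      · obtain ⟨rfl, rfl⟩ := hb
        subst hc
        exact ht.trans hlt
      · rwa [hθ _ hb]
    by_cases h' : dir θ' t = (if c then 2 else 1)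
    · rw [if_pos h', if_pos (himp h')]
    · rw [if_neg h']; split_ifs <;> simp
  · obtain ⟨t, ht, rfl, rfl, rfl, hr⟩ := exists_time j i c (hlt.trans (ZMod.val_lt _))
    refine ⟨t, Finset.mem_range.2 (ht.trans_le hn), ?_⟩
    rw [if_neg, if_pos]
    · norm_num
    · rw [dir_eq_iff]
      exact ⟨hr.trans_lt hlt, rfl⟩
    · rw [dir_eq_iff]
      exact fun h => h.1.ne hr

theorem eq_of_walk_eq (hd : 3 ≤ d) (x : Fin d → ℤ) {j i n : ℕ} (hn : 4 * 8 ^ j * (i + 1) ≤ n)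
    {θ θ' : Choices} (hθ : ∀ b : ℕ × ℕ × Bool, ¬(b.1 = j ∧ b.2.1 = i) → θ b = θ' b)
    (h : walk hd x n θ = walk hd x n θ') (c : Bool) :
    θ (j, i, c) = θ' (j, i, c) :=
  ZMod.val_injective _ (le_antisymm (val_le_of_walk_eq hd x hn hθ h c)
    (val_le_of_walk_eq hd x hn (fun b hb => (hθ b hb).symm) h.symm c))

/-- The choices which are `a` in block `i` of scale `j`, and `0` elsewhere. -/
def shift (j i : ℕ) (a : ZMod (4 ^ j) × ZMod (4 ^ j)) : Choices :=
  Pi.single (M := fun b : ℕ × ℕ × Bool => ZMod (4 ^ b.1)) (j, i, false) a.1 +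
    Pi.single (M := fun b : ℕ × ℕ × Bool => ZMod (4 ^ b.1)) (j, i, true) a.2

theorem shift_apply_of_ne {j i : ℕ} (a : ZMod (4 ^ j) × ZMod (4 ^ j)) {b : ℕ × ℕ × Bool}
    (hb : ¬(b.1 = j ∧ b.2.1 = i)) : shift j i a b = 0 := by
  have h : ∀ c, b ≠ (j, i, c) := by rintro c rfl; exact hb ⟨rfl, rfl⟩
  simp [shift, h]

theorem shift_apply_false (j i : ℕ) (a : ZMod (4 ^ j) × ZMod (4 ^ j)) :
    shift j i a (j, i, false) = a.1 := by
  simp [shift]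

theorem shift_apply_true (j i : ℕ) (a : ZMod (4 ^ j) × ZMod (4 ^ j)) :
    shift j i a (j, i, true) = a.2 := by
  simp [shift]

theorem dir_add_shift {j l t : ℕ} (ht : t < l) (θ : Choices) (a : ZMod (4 ^ j) × ZMod (4 ^ j)) :
    dir (θ + shift j (l / (4 * 8 ^ j) + 1) a) t = dir θ t := by
  have hb : ¬(scale t = j ∧ block t = l / (4 * 8 ^ j) + 1) := by
    rintro ⟨rfl, hb⟩
    have h1 := block_le t
    rw [hb] at h1
    have := Nat.lt_mul_div_succ l (show 0 < 4 * 8 ^ scale t by positivity)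
    omega
  simp only [dir, Turns, Pi.add_apply, shift_apply_of_ne a (b := (scale t, block t, colour t)) hb,
    add_zero]
  congr

/-- Resampling one full block of scale `j` after time `l` leaves the past unchanged, and at most one
of the 16^j outcomes leads to `y`. -/
theorem lintegral_walk_eq_le (hd : 3 ≤ d) (x : Fin d → ℤ) {j l k : ℕ} (hk : 8 * 8 ^ j ≤ k)
    (y : Fin d → ℤ) {W : Choices → ℝ≥0∞} (hW : Measurable W)
    (hWl : ∀ θ θ', (∀ i ≤ l, walk hd x i θ = walk hd x i θ') → W θ = W θ') :
    16 ^ j * ∫⁻ θ, {θ | walk hd x (l + k) θ = y}.indicator W θ ∂choiceMeasure ≤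
      ∫⁻ θ, W θ ∂choiceMeasure := by
  classical
  -- The first block certain to have no step before `l`; two block lengths after `l` suffice to
  -- complete it, hence `8 * 8 ^ j ≤ k`.
  set i := l / (4 * 8 ^ j) + 1 with hi
  have hn : 4 * 8 ^ j * (i + 1) ≤ l + k := by
    have := Nat.mul_div_le l (4 * 8 ^ j)
    rw [hi, mul_add, mul_add]
    omega
  set A := {θ | walk hd x (l + k) θ = y} with hA
  have hAm : MeasurableSet A := measurable_walk hd x (l + k) (measurableSet_singleton y)
  have hpt : ∀ θ, ∑ a : ZMod (4 ^ j) × ZMod (4 ^ j), A.indicator W (θ + shift j i a) ≤ W θ := by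
    intro θ
    have hW' : ∀ a, W (θ + shift j i a) = W θ := fun a => hWl _ _ fun m hm =>
      walk_congr hd x fun t ht => dir_add_shift (ht.trans_le hm) θ a
    by_cases h : ∃ a, θ + shift j i a ∈ A
    · obtain ⟨a, ha⟩ := h
      rw [Finset.sum_eq_single a]
      · rw [Set.indicator_of_mem ha, hW']
      · intro a' _ hne
        refine Set.indicator_of_notMem (fun ha' => hne ?_) _
        have heq := eq_of_walk_eq hd x hn (θ := θ + shift j i a') (θ' := θ + shift j i a)
          (fun b hb => by simp [shift_apply_of_ne _ hb]) (Eq.trans ha' (Eq.symm ha))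
        have h0 := heq false
        have h1 := heq true
        simp only [Pi.add_apply, shift_apply_false, shift_apply_true, add_right_inj] at h0 h1
        exact Prod.ext h0 h1
      · simp
    · push Not at h
      rw [Finset.sum_eq_zero fun a _ => Set.indicator_of_notMem (h a) _]
      exact zero_le
  have hm : Measurable (A.indicator W) := hW.indicator hAm
  calc 16 ^ j * ∫⁻ θ, A.indicator W θ ∂choiceMeasure
      = ∑ a : ZMod (4 ^ j) × ZMod (4 ^ j), ∫⁻ θ, A.indicator W (θ + shift j i a) ∂choiceMeasure := by
        simp_rw [fun a => (measurePreserving_add (shift j i a)).lintegral_comp hm]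
        rw [Finset.sum_const, Finset.card_univ, Fintype.card_prod, ZMod.card, nsmul_eq_mul,
          ← mul_pow]
        norm_num
    _ = ∫⁻ θ, ∑ a : ZMod (4 ^ j) × ZMod (4 ^ j), A.indicator W (θ + shift j i a) ∂choiceMeasure :=
        (lintegral_finsetSum _ fun a _ => hm.comp (measurePreserving_add _).measurable).symm
    _ ≤ ∫⁻ θ, W θ ∂choiceMeasure := lintegral_mono hpt

/-- A bound for the probability that the walk is at a given point after `k` further steps. -/
noncomputable def hitBound (k : ℕ) : ℝ≥0∞ := ENNReal.ofReal (256 * ((k : ℝ) ^ (4 / 3 : ℝ))⁻¹)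

/-- The exponent 4/3 exceeds 1. The term at 0 is 0 by the convention for inverses, harmless as only
positive `k` are used for hitting. -/
theorem tsum_hitBound_ne_top : ∑' k, hitBound k ≠ ∞ := by
  have h : Summable fun k : ℕ => 256 * ((k : ℝ) ^ (4 / 3 : ℝ))⁻¹ :=
    (Real.summable_nat_rpow_inv.2 (by norm_num)).mul_left _
  exact h.tsum_ofReal_ne_top

theorem eight_pow_rpow (j : ℕ) : ((8 : ℝ) ^ j) ^ (4 / 3 : ℝ) = 16 ^ j := by
  rw [show (8 : ℝ) = 2 ^ (3 : ℝ) by norm_num, show (16 : ℝ) = 2 ^ (4 : ℝ) by norm_num,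
    ← Real.rpow_natCast, ← Real.rpow_natCast, ← Real.rpow_mul (by norm_num),
    ← Real.rpow_mul (by norm_num), ← Real.rpow_mul (by norm_num)]
  congr 1
  ring

/-- As 8^(4/3) = 16, the two spare scales in `hk` cost the factor 256 = 16^2. -/
theorem inv_pow_le_hitBound {j k : ℕ} (hk0 : 0 < k) (hk : k ≤ 8 ^ (j + 2)) :
    ((16 : ℝ≥0∞) ^ j)⁻¹ ≤ hitBound k := by
  have h1 : ((k : ℝ) ^ (4 / 3 : ℝ)) ≤ 16 ^ (j + 2) := by
    rw [← eight_pow_rpow]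
    exact Real.rpow_le_rpow (by positivity) (by exact_mod_cast hk) (by norm_num)
  have h2 : ((16 : ℝ) ^ j)⁻¹ ≤ 256 * ((k : ℝ) ^ (4 / 3 : ℝ))⁻¹ := by
    have hpos : 0 < (k : ℝ) ^ (4 / 3 : ℝ) := Real.rpow_pos_of_pos (by exact_mod_cast hk0) _
    rw [← div_eq_mul_inv, inv_eq_one_div, div_le_div_iff₀ (by positivity) hpos, one_mul]
    calc _ ≤ _ := h1
      _ = 256 * 16 ^ j := by rw [pow_add]; norm_num; ring
  calc ((16 : ℝ≥0∞) ^ j)⁻¹ = ENNReal.ofReal ((16 : ℝ) ^ j)⁻¹ := by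
        rw [ENNReal.ofReal_inv_of_pos (by positivity), ENNReal.ofReal_pow (by norm_num)]
        norm_num
    _ ≤ hitBound k := ENNReal.ofReal_le_ofReal h2

theorem lintegral_walk_eq_le_hitBound (hd : 3 ≤ d) (x : Fin d → ℤ) (l k : ℕ) (hk : 0 < k)
    (y : Fin d → ℤ) (W : Choices → ℝ≥0∞) (hW : Measurable W)
    (hWl : ∀ θ θ', (∀ i ≤ l, walk hd x i θ = walk hd x i θ') → W θ = W θ') :
    ∫⁻ θ, {θ | walk hd x (l + k) θ = y}.indicator W θ ∂choiceMeasure ≤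
      hitBound k * ∫⁻ θ, W θ ∂choiceMeasure := by
  rcases lt_or_ge k 8 with h8 | h8
  · have h1 : 1 ≤ hitBound k := by
      simpa using inv_pow_le_hitBound (j := 0) hk (by omega)
    calc _ ≤ ∫⁻ θ, W θ ∂choiceMeasure := lintegral_mono (Set.indicator_le_self _ _)
      _ = 1 * ∫⁻ θ, W θ ∂choiceMeasure := (one_mul _).symm
      _ ≤ _ := by gcongr
  · obtain ⟨j, hj⟩ : ∃ j, Nat.log 8 k = j + 1 :=
      Nat.exists_eq_succ_of_ne_zero (Nat.log_pos (by norm_num) h8).ne'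
    have hlow : 8 * 8 ^ j ≤ k := by
      have := Nat.pow_log_le_self 8 hk.ne'
      rwa [hj, pow_succ'] at this
    have hup : k ≤ 8 ^ (j + 2) := by
      have := Nat.lt_pow_succ_log_self (b := 8) (by norm_num) k
      rw [hj] at this
      exact this.le
    have h := lintegral_walk_eq_le hd x hlow y hW hWl
    calc _ ≤ ((16 : ℝ≥0∞) ^ j)⁻¹ * ∫⁻ θ, W θ ∂choiceMeasure := by
          rw [mul_comm, ← div_eq_mul_inv]
          refine (ENNReal.le_div_iff_mul_le (Or.inl (by simp)) (Or.inl (by simp))).2 ?_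
          rwa [mul_comm]
      _ ≤ _ := by gcongr; exact inv_pow_le_hitBound hk hup

/-- Walks of two independent sets of choices have exponential intersection tails. -/
theorem exists_lintegral_meeting_le :
    ∃ ρ : ℝ, 1 < ρ ∧ ∃ C : ℝ≥0∞, C ≠ ∞ ∧ ∀ (d : ℕ) (hd : 3 ≤ d) (x : Fin d → ℤ) (z : ℕ → Fin d → ℤ)
      (n : ℕ), ∫⁻ θ, ∏ i ∈ Finset.range n,
        (if walk hd x i θ = z i then ENNReal.ofReal ρ else 1) ∂choiceMeasure ≤ C := by
  set c := ∑' k, hitBound k with hc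
  have hcf : c ≠ ∞ := tsum_hitBound_ne_top
  -- Small enough for `t * c ≤ 1 / 2`. It does not depend on `d`: the walk moves in three
  -- coordinates only.
  set t : ℝ := (2 * (c.toReal + 1))⁻¹ with ht
  have htpos : 0 < t := by positivity
  refine ⟨1 + t, by linarith, 1 + ENNReal.ofReal t * (2 * (1 + c)), ?_, fun d hd x z n => ?_⟩
  · exact ENNReal.add_ne_top.2 ⟨by simp, ENNReal.mul_ne_top (by simp)
      (ENNReal.mul_ne_top (by simp) (by simp [hcf]))⟩
  · have htc : ENNReal.ofReal t * c ≤ 1 / 2 := by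
      rw [← ENNReal.ofReal_toReal hcf, ← ENNReal.ofReal_mul htpos.le,
        show (1 / 2 : ℝ≥0∞) = ENNReal.ofReal (1 / 2) by
          rw [ENNReal.ofReal_div_of_pos (by norm_num)]; simp]
      refine ENNReal.ofReal_le_ofReal ?_
      rw [ht, inv_mul_le_iff₀ (by positivity)]
      linarith
    have h := lintegral_prod_meeting_le choiceMeasure (measurable_walk hd x)
      (lintegral_walk_eq_le_hitBound hd x) z (t := ENNReal.ofReal t) (by simp) htc n
    rwa [ENNReal.ofReal_add zero_le_one htpos.le, ENNReal.ofReal_one]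

end OrientedWalk

/-! ### The successor map along the walk. -/

namespace OrientedWalk

variable {d : ℕ}

/-- The only time at which the walk from `x` can visit `v`. -/
def level (x v : Fin d → ℤ) : ℕ := (∑ i, x i - ∑ i, v i).toNat

theorem level_walk (hd : 3 ≤ d) (x : Fin d → ℤ) (n : ℕ) (θ : Choices) :
    level x (walk hd x n θ) = n := by
  simp [level, sum_walk]

/-- The successor of `v` along the walk, and `v` itself off the walk. -/
noncomputable def next (hd : 3 ≤ d) (x : Fin d → ℤ) (θ : Choices) (v : Fin d → ℤ) : Fin d → ℤ :=
  if walk hd x (level x v) θ = v then walk hd x (level x v + 1) θ else v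

theorem next_walk (hd : 3 ≤ d) (x : Fin d → ℤ) (θ : Choices) (n : ℕ) :
    next hd x θ (walk hd x n θ) = walk hd x (n + 1) θ := by
  simp [next, level_walk]

theorem next_of_ne (hd : 3 ≤ d) (x : Fin d → ℤ) (θ : Choices) {v : Fin d → ℤ}
    (h : walk hd x (level x v) θ ≠ v) : next hd x θ v = v := if_neg h

theorem walk_ne_of_level (hd : 3 ≤ d) (x : Fin d → ℤ) (θ : Choices) {v : Fin d → ℤ}
    (h : walk hd x (level x v) θ ≠ v) (n : ℕ) : walk hd x n θ ≠ v := by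
  rintro rfl
  rw [level_walk] at h
  exact h rfl

theorem next_injective (hd : 3 ≤ d) (x : Fin d → ℤ) (θ : Choices) :
    Function.Injective (next hd x θ) := by
  intro v w h
  by_cases hv : walk hd x (level x v) θ = v <;> by_cases hw : walk hd x (level x w) θ = w
  · rw [← hv, ← hw, next_walk, next_walk] at h
    have := congrArg (level x) h
    rw [level_walk, level_walk] at this
    rw [← hv, ← hw, Nat.succ_injective this]
  · rw [next_of_ne hd x θ hw, ← hv, next_walk] at h
    exact absurd h (walk_ne_of_level hd x θ hw _)
  · rw [next_of_ne hd x θ hv, ← hw, next_walk] at h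
    exact absurd h.symm (walk_ne_of_level hd x θ hv _)
  · rwa [next_of_ne hd x θ hv, next_of_ne hd x θ hw] at h

/-- A one-sided shift along the path omits only its starting vertex; this is how a label is freed.
-/
theorem exists_next_eq_iff (hd : 3 ≤ d) (x : Fin d → ℤ) (θ : Choices) (w : Fin d → ℤ) :
    (∃ v, next hd x θ v = w) ↔ w ≠ x := by
  constructor
  · rintro ⟨v, rfl⟩ h
    by_cases hv : walk hd x (level x v) θ = v
    · rw [← hv, next_walk, ← walk_zero hd x θ] at h
      have := congrArg (level x) h
      rw [walk_zero, level_walk] at this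
      simp [level] at this
    · rw [next_of_ne hd x θ hv] at h
      subst h
      exact walk_ne_of_level hd v θ hv 0 (walk_zero hd v θ)
  · intro hw
    by_cases h : walk hd x (level x w) θ = w
    · obtain ⟨n, hn⟩ : ∃ n, level x w = n + 1 :=
        Nat.exists_eq_succ_of_ne_zero fun h0 => by
          rw [h0, walk_zero] at h
          exact hw h.symm
      exact ⟨walk hd x n θ, by rw [next_walk, ← hn, h]⟩
    · exact ⟨w, next_of_ne hd x θ h⟩

theorem measurable_next (hd : 3 ≤ d) (x v : Fin d → ℤ) : Measurable fun θ => next hd x θ v := by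
  unfold next
  exact Measurable.ite (measurable_walk hd x _ (measurableSet_singleton v))
    (measurable_walk hd x _) measurable_const

theorem next_sub_of_eq (hd : 3 ≤ d) (x : Fin d → ℤ) (θ : Choices) {v : Fin d → ℤ}
    (h : walk hd x (level x v) θ = v) : ∃ i : Fin d, next hd x θ v - v = -Pi.single i 1 := by
  refine ⟨Fin.castLE hd (dir θ (level x v)), ?_⟩
  have : next hd x θ v = v - Pi.single (Fin.castLE hd (dir θ (level x v))) 1 := by
    rw [next, if_pos h, walk_succ, h]
  rw [this]; abel

/-- `level x` maps the common vertices injectively to meeting times. -/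
theorem prod_common_le (hd : 3 ≤ d) (x : Fin d → ℤ) (θ θ' : Choices) {F : Finset (Fin d → ℤ)}
    {N : ℕ} (hN : ∀ v ∈ F, level x v < N) {ρ : ℝ≥0∞} (hρ : 1 ≤ ρ) :
    ∏ v ∈ F, (if walk hd x (level x v) θ = v ∧ walk hd x (level x v) θ' = v then ρ else 1) ≤
      ∏ n ∈ Finset.range N, (if walk hd x n θ' = walk hd x n θ then ρ else 1) := by
  simp only [Finset.prod_ite, Finset.prod_const, one_pow, mul_one]
  refine pow_le_pow_right₀ hρ (Finset.card_le_card_of_injOn (level x) ?_ ?_)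
  · intro v hv
    simp only [Finset.coe_filter, Set.mem_ofPred_eq, Finset.mem_range] at hv ⊢
    exact ⟨hN v hv.1, hv.2.2.trans hv.2.1.symm⟩
  · intro v hv w hw h
    simp only [Finset.coe_filter, Set.mem_ofPred_eq] at hv hw
    rw [← hv.2.1, ← hw.2.1, h]

end OrientedWalk

/-! ### Density ratios of translates. -/

section Density

variable {d : ℕ}

/-- The inclusion of `ℤ ^ d` into `ℝ ^ d`. -/
def latticePoint (v : Fin d → ℤ) : Fin d → ℝ := fun i => (v i : ℝ)

theorem latticePoint_neg_single (i : Fin d) :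
    latticePoint (-Pi.single i 1) = -Pi.single i 1 := by
  funext j
  by_cases h : j = i
  · subst h; simp [latticePoint]
  · simp [latticePoint, h]

/-- The measure with density `g`. -/
noncomputable def densityMeasure (g : (Fin d → ℝ) → ℝ) : Measure (Fin d → ℝ) :=
  volume.withDensity fun y => ENNReal.ofReal (g y)

/-- The density of the translate by `a` of the measure with density `g`, relative to that
measure. -/
noncomputable def shiftRatio (g : (Fin d → ℝ) → ℝ) (a z : Fin d → ℝ) : ℝ≥0∞ :=
  ENNReal.ofReal (g (z - a) / g z)

variable {g : (Fin d → ℝ) → ℝ}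

theorem measurable_shiftRatio (hg : Measurable g) (a : Fin d → ℝ) :
    Measurable (shiftRatio g a) := by
  unfold shiftRatio
  fun_prop

theorem map_add_densityMeasure (hg : Measurable g) (hpos : ∀ x, 0 < g x) (a : Fin d → ℝ) :
    (densityMeasure g).map (· + a) = (densityMeasure g).withDensity (shiftRatio g a) := by
  have h1 : (densityMeasure g).withDensity (shiftRatio g a) =
      volume.withDensity fun z => ENNReal.ofReal (g (z - a)) := by
    unfold densityMeasure
    rw [← withDensity_mul _ (by fun_prop) (measurable_shiftRatio hg a)]
    congr 1
    funext z
    rw [Pi.mul_apply, shiftRatio, ← ENNReal.ofReal_mul (hpos z).le, mul_div_cancel₀ _ (hpos z).ne']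
  rw [h1]
  ext s hs
  have hm : Measurable fun z : Fin d → ℝ => z + a := by fun_prop
  rw [Measure.map_apply hm hs, densityMeasure, withDensity_apply _ (hm hs),
    withDensity_apply _ hs, ← (measurePreserving_add_right volume a).setLIntegral_comp_preimage hs
      (by fun_prop)]
  simp

theorem lintegral_shiftRatio (hg : Measurable g) (hpos : ∀ x, 0 < g x)
    [IsProbabilityMeasure (densityMeasure g)] (a : Fin d → ℝ) :
    ∫⁻ z, shiftRatio g a z ∂(densityMeasure g) = 1 := by
  rw [← setLIntegral_univ, ← withDensity_apply _ .univ, ← map_add_densityMeasure hg hpos,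
    Measure.map_apply (by fun_prop) .univ]
  simp

theorem shiftRatio_zero (hpos : ∀ x, 0 < g x) (z : Fin d → ℝ) : shiftRatio g 0 z = 1 := by
  rw [shiftRatio, sub_zero, div_self (hpos z).ne', ENNReal.ofReal_one]

/-- The walk steps by -e_i so that the ratio is g(z + e_i) / g(z), as in the hypothesis on `g`. -/
theorem lintegral_shiftRatio_sq (hg : Measurable g) (hpos : ∀ x, 0 < g x) (i : Fin d) :
    ∫⁻ z, shiftRatio g (-Pi.single i 1) z ^ 2 ∂(densityMeasure g) =
      shiftRatioSecondMoment g i := by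
  rw [densityMeasure, lintegral_withDensity_eq_lintegral_mul _ (by fun_prop)
    ((measurable_shiftRatio hg _).pow_const 2)]
  refine lintegral_congr fun z => ?_
  rw [Pi.mul_apply, shiftRatio, sub_neg_eq_add,
    ← ENNReal.ofReal_pow (div_pos (hpos _) (hpos _)).le, ← ENNReal.ofReal_mul (hpos z).le, mul_comm]

theorem lintegral_shiftRatio_mul_le (hg : Measurable g) (hpos : ∀ x, 0 < g x) {ρ : ℝ≥0∞}
    (hρ : ∀ i, shiftRatioSecondMoment g i ≤ ρ) (i j : Fin d) :
    ∫⁻ z, shiftRatio g (-Pi.single i 1) z * shiftRatio g (-Pi.single j 1) z ∂(densityMeasure g) ≤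
      ρ := by
  have hamgm : ∀ a b : ℝ≥0∞, a * b ≤ 2⁻¹ * a ^ 2 + 2⁻¹ * b ^ 2 := by
    intro a b
    rcases eq_or_ne a ∞ with rfl | ha
    · simp [ENNReal.mul_top]
    rcases eq_or_ne b ∞ with rfl | hb
    · simp [ENNReal.mul_top]
    lift a to NNReal using ha
    lift b to NNReal using hb
    rw [← ENNReal.coe_inv_two]
    norm_cast
    rw [← NNReal.coe_le_coe]
    push_cast
    nlinarith [sq_nonneg ((a : ℝ) - b)]
  calc _ ≤ ∫⁻ z, (2⁻¹ * shiftRatio g (-Pi.single i 1) z ^ 2 +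
        2⁻¹ * shiftRatio g (-Pi.single j 1) z ^ 2) ∂(densityMeasure g) :=
        lintegral_mono fun z => hamgm _ _
    _ = 2⁻¹ * shiftRatioSecondMoment g i + 2⁻¹ * shiftRatioSecondMoment g j := by
        have hm := fun i : Fin d => (measurable_shiftRatio hg (-Pi.single i 1)).pow_const 2
        rw [lintegral_add_left ((hm i).const_mul _), lintegral_const_mul _ (hm i),
          lintegral_const_mul _ (hm j), lintegral_shiftRatio_sq hg hpos,
          lintegral_shiftRatio_sq hg hpos]
    _ ≤ 2⁻¹ * ρ + 2⁻¹ * ρ := by gcongr <;> exact hρ _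
    _ = ρ := by rw [← add_mul, ENNReal.inv_two_add_inv_two, one_mul]

end Density

/-! ### Sliding the perturbations along the walk. -/

section Sliding

variable {d : ℕ}

/-- The configuration of the points `v + y v` with `v ≠ x`. -/
def configWithout (x : Fin d → ℤ) (y : (Fin d → ℤ) → Fin d → ℝ) : PointConfig (Fin d → ℝ) :=
  ⟨{z | ∃ v, v ≠ x ∧ latticePoint v + y v = z}⟩

theorem measurable_perturbedLattice :
    Measurable (perturbedLattice fun v (y : (Fin d → ℤ) → Fin d → ℝ) => y v) := by
  have := PointConfig.measurable_of_labels (ι := Fin d → ℤ) (E := Fin d → ℝ)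
    (f := fun v (y : (Fin d → ℤ) → Fin d → ℝ) => latticePoint v + y v) (by fun_prop)
    (D := fun _ => Set.univ) (fun _ => .univ)
  convert this using 2 with y
  ext z
  simp only [perturbedLattice, Set.mem_range, Set.mem_ofPred_eq, Set.mem_univ, true_and]
  rfl

theorem measurable_configWithout (x : Fin d → ℤ) : Measurable (configWithout x) := by
  exact PointConfig.measurable_of_labels (ι := Fin d → ℤ) (E := Fin d → ℝ)
    (f := fun v (y : (Fin d → ℤ) → Fin d → ℝ) => latticePoint v + y v) (by fun_prop)
    (D := fun v => {_y | v ≠ x}) (fun _ => .const _)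

theorem measurable_erase_perturbedLattice :
    Measurable fun p : ((Fin d → ℤ) → Fin d → ℝ) × (Fin d → ℝ) =>
      (perturbedLattice (fun v (y : (Fin d → ℤ) → Fin d → ℝ) => y v) p.1).erase p.2 := by
  have := PointConfig.measurable_of_labels (ι := Fin d → ℤ) (E := Fin d → ℝ)
    (f := fun v (p : ((Fin d → ℤ) → Fin d → ℝ) × (Fin d → ℝ)) => latticePoint v + p.1 v)
    (by fun_prop) (D := fun v => {p | latticePoint v + p.1 v = p.2}ᶜ)
    (fun v => (measurableSet_eq_fun (by fun_prop) (by fun_prop)).compl)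
  convert this using 2 with p
  ext z
  simp only [perturbedLattice, PointConfig.erase, Set.mem_sdiff, Set.mem_range,
    Set.mem_singleton_iff, Set.mem_ofPred_eq, Set.mem_compl_iff]
  constructor
  · rintro ⟨⟨v, rfl⟩, h⟩
    exact ⟨v, h, rfl⟩
  · rintro ⟨v, h, rfl⟩
    exact ⟨⟨v, rfl⟩, h⟩

/-- Injectivity of `σ` keeps the relabelled coordinates independent; surjectivity is not needed, so
the missing label does no harm. -/
theorem infinitePi_map_comp_add {ι E : Type*} [MeasurableSpace E] [Add E]
    [MeasurableAdd E] (ν : Measure E) [IsProbabilityMeasure ν] {σ : ι → ι}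
    (hσ : Function.Injective σ) (a : ι → E) :
    (Measure.infinitePi fun _ : ι => ν).map (fun y v => y (σ v) + a v) =
      Measure.infinitePi fun v => ν.map (· + a v) := by
  have h := ((iIndepFun_infinitePi (P := fun _ : ι => ν) (X := fun _ z => z)
    (fun _ => measurable_id)).precomp hσ).comp (fun v z => z + a v) (fun v => by fun_prop)
  have h2 := h.map_fun_eq_infinitePi_map (fun v => by fun_prop)
  refine h2.trans ?_
  congr 1
  funext v
  refine (Measure.map_map (μ := Measure.infinitePi fun _ : ι => ν) (g := (· + a v)) (by fun_prop)
    (measurable_pi_apply (σ v))).symm.trans ?_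
  rw [Measure.infinitePi_map_eval]

theorem ae_ne_of_infinitePi {ι E : Type*} [MeasurableSpace E] [MeasurableEq E] [AddGroup E]
    [MeasurableAdd E] [Countable ι] (ν : Measure E) [IsProbabilityMeasure ν] [NullSingletonClass ν]
    (a : ι → E) :
    ∀ᵐ y ∂(Measure.infinitePi fun _ : ι => ν), ∀ v w, v ≠ w → a v + y v ≠ a w + y w := by
  rw [ae_all_iff]; intro v
  rw [ae_all_iff]; intro w
  by_cases hvw : v = w
  · simp [hvw]
  have h := (iIndepFun_infinitePi (P := fun _ : ι => ν) (X := fun _ z => z)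
    (fun _ => measurable_id)).indepFun hvw
  rw [indepFun_iff_map_prod_eq_prod_map_map (measurable_pi_apply v).aemeasurable
      (measurable_pi_apply w).aemeasurable,
    Measure.infinitePi_map_eval, Measure.infinitePi_map_eval] at h
  have hS : MeasurableSet {p : E × E | a v + p.1 = a w + p.2} :=
    measurableSet_eq_fun (by fun_prop) (by fun_prop)
  have h0 : (ν.prod ν) {p : E × E | a v + p.1 = a w + p.2} = 0 := by
    rw [Measure.measure_prod_null hS]
    refine Filter.Eventually.of_forall fun z => ?_
    have : Prod.mk z ⁻¹' {p : E × E | a v + p.1 = a w + p.2} = {-a w + (a v + z)} := by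
      ext z'
      simp [eq_neg_add_iff_add_eq, eq_comm]
    change ν (Prod.mk z ⁻¹' _) = 0
    rw [this]
    exact measure_singleton _
  rw [← h, Measure.map_apply (by fun_prop) hS] at h0
  filter_upwards [measure_eq_zero_iff_ae_notMem.1 h0] with y hy _
  exact hy

/-- The perturbations by which the lattice without `x` becomes the full lattice: each point of the
walk takes over the perturbed point of its successor. -/
noncomputable def slide (hd : 3 ≤ d) (x : Fin d → ℤ)
    (p : OrientedWalk.Choices × ((Fin d → ℤ) → Fin d → ℝ)) (v : Fin d → ℤ) : Fin d → ℝ :=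
  p.2 (OrientedWalk.next hd x p.1 v) + latticePoint (OrientedWalk.next hd x p.1 v - v)

theorem measurable_slide (hd : 3 ≤ d) (x : Fin d → ℤ) : Measurable (slide hd x) := by
  refine measurable_pi_iff.2 fun v => ?_
  have h : Measurable fun q : (Fin d → ℤ) × ((Fin d → ℤ) → Fin d → ℝ) =>
      q.2 q.1 + latticePoint (q.1 - v) :=
    measurable_from_prod_countable_right fun w => by
      dsimp only
      exact (measurable_pi_apply w).add_const _
  exact h.comp (((OrientedWalk.measurable_next hd x v).comp measurable_fst).prodMk measurable_snd)

theorem perturbedLattice_slide (hd : 3 ≤ d) (x : Fin d → ℤ)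
    (p : OrientedWalk.Choices × ((Fin d → ℤ) → Fin d → ℝ)) :
    perturbedLattice (fun v (y : (Fin d → ℤ) → Fin d → ℝ) => y v) (slide hd x p) =
      configWithout x p.2 := by
  have hpt : ∀ v, latticePoint v + slide hd x p v =
      latticePoint (OrientedWalk.next hd x p.1 v) + p.2 (OrientedWalk.next hd x p.1 v) := by
    intro v
    funext i
    simp only [slide, latticePoint, Pi.add_apply, Pi.sub_apply, Int.cast_sub]
    ring
  ext z
  change (∃ v, latticePoint v + slide hd x p v = z) ↔ ∃ v, v ≠ x ∧ latticePoint v + p.2 v = z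
  simp_rw [hpt]
  constructor
  · rintro ⟨v, h⟩
    exact ⟨_, (OrientedWalk.exists_next_eq_iff hd x p.1 _).1 ⟨v, rfl⟩, h⟩
  · rintro ⟨w, hw, h⟩
    obtain ⟨v, rfl⟩ := (OrientedWalk.exists_next_eq_iff hd x p.1 w).2 hw
    exact ⟨v, h⟩

/-- At a vertex missed by either walk one ratio is 1 and the other integrates to 1, so only common
vertices cost a factor `ρ`. -/
theorem lintegral_prod_shiftRatio_le (hd : 3 ≤ d) (x : Fin d → ℤ) {g : (Fin d → ℝ) → ℝ}
    (hg : Measurable g) (hpos : ∀ x, 0 < g x) [IsProbabilityMeasure (densityMeasure g)]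
    {ρ : ℝ≥0∞} (hρ1 : 1 ≤ ρ) (hρ : ∀ i, shiftRatioSecondMoment g i ≤ ρ) (F : Finset (Fin d → ℤ))
    {N : ℕ} (hN : ∀ v ∈ F, OrientedWalk.level x v < N) (θ θ' : OrientedWalk.Choices) :
    ∏ v ∈ F, ∫⁻ z, shiftRatio g (latticePoint (OrientedWalk.next hd x θ v - v)) z *
        shiftRatio g (latticePoint (OrientedWalk.next hd x θ' v - v)) z ∂(densityMeasure g) ≤
      ∏ n ∈ Finset.range N, (if OrientedWalk.walk hd x n θ' = OrientedWalk.walk hd x n θ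
        then ρ else 1) := by
  refine le_trans (Finset.prod_le_prod' fun v _ => ?_)
    (OrientedWalk.prod_common_le hd x θ θ' hN hρ1)
  have hz : latticePoint (0 : Fin d → ℤ) = 0 := by funext i; simp [latticePoint]
  by_cases h : OrientedWalk.walk hd x (OrientedWalk.level x v) θ = v
  · by_cases h' : OrientedWalk.walk hd x (OrientedWalk.level x v) θ' = v
    · rw [if_pos ⟨h, h'⟩]
      obtain ⟨i, hi⟩ := OrientedWalk.next_sub_of_eq hd x θ h
      obtain ⟨j, hj⟩ := OrientedWalk.next_sub_of_eq hd x θ' h'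
      rw [hi, hj, latticePoint_neg_single, latticePoint_neg_single]
      exact lintegral_shiftRatio_mul_le hg hpos hρ i j
    · rw [if_neg fun h2 => h' h2.2, OrientedWalk.next_of_ne hd x θ' h', sub_self, hz]
      simp_rw [shiftRatio_zero hpos, mul_one]
      exact (lintegral_shiftRatio hg hpos _).le
  · rw [if_neg fun h2 => h h2.1, OrientedWalk.next_of_ne hd x θ h, sub_self, hz]
    simp_rw [shiftRatio_zero hpos, one_mul]
    exact (lintegral_shiftRatio hg hpos _).le

theorem measurable_shiftRatio_next (hd : 3 ≤ d) (x v : Fin d → ℤ) {g : (Fin d → ℝ) → ℝ}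
    (hg : Measurable g) : Measurable fun p : OrientedWalk.Choices × (Fin d → ℝ) =>
      shiftRatio g (latticePoint (OrientedWalk.next hd x p.1 v - v)) p.2 := by
  have h : Measurable fun q : (Fin d → ℤ) × (Fin d → ℝ) =>
      shiftRatio g (latticePoint (q.1 - v)) q.2 :=
    measurable_from_prod_countable_right fun w => by
      dsimp only
      exact measurable_shiftRatio hg _
  have h2 : Measurable fun p : OrientedWalk.Choices × (Fin d → ℝ) =>
      (OrientedWalk.next hd x p.1 v, p.2) :=
    ((OrientedWalk.measurable_next hd x v).comp measurable_fst).prodMk measurable_snd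
  exact h.comp h2

/-- The law of the slid perturbations is absolutely continuous. -/
theorem map_slide_absolutelyContinuous (hd : 3 ≤ d) (x : Fin d → ℤ) {g : (Fin d → ℝ) → ℝ}
    (hg : Measurable g) (hpos : ∀ x, 0 < g x) [IsProbabilityMeasure (densityMeasure g)]
    {ρ : ℝ≥0∞} (hρ1 : 1 ≤ ρ) (hρ : ∀ i, shiftRatioSecondMoment g i ≤ ρ) {C : ℝ≥0∞} (hC : C ≠ ∞)
    (hmeet : ∀ (z : ℕ → Fin d → ℤ) (n : ℕ), ∫⁻ θ, ∏ i ∈ Finset.range n,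
      (if OrientedWalk.walk hd x i θ = z i then ρ else 1) ∂OrientedWalk.choiceMeasure ≤ C) :
    ((OrientedWalk.choiceMeasure.prod
      (Measure.infinitePi fun _ : Fin d → ℤ => densityMeasure g)).map (slide hd x)) ≪
      Measure.infinitePi fun _ : Fin d → ℤ => densityMeasure g := by
  have : IsProbabilityMeasure ((OrientedWalk.choiceMeasure.prod
      (Measure.infinitePi fun _ : Fin d → ℤ => densityMeasure g)).map (slide hd x)) :=
    Measure.isProbabilityMeasure_map (measurable_slide hd x).aemeasurable
  refine absolutelyContinuous_of_mixture (densityMeasure g) OrientedWalk.choiceMeasure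
    (r := fun θ v => shiftRatio g (latticePoint (OrientedWalk.next hd x θ v - v)))
    (fun v => ?_) (fun θ v => lintegral_shiftRatio hg hpos _) (fun A hA => ?_) hC (fun F => ?_)
  · exact measurable_shiftRatio_next hd x v hg
  · rw [Measure.map_apply (measurable_slide hd x) hA,
      Measure.prod_apply (measurable_slide hd x hA)]
    refine lintegral_congr fun θ => ?_
    simp_rw [← map_add_densityMeasure hg hpos]
    rw [← infinitePi_map_comp_add (densityMeasure g) (OrientedWalk.next_injective hd x θ),
      Measure.map_apply (by fun_prop) hA]
    rfl
  · obtain ⟨N, hN⟩ : ∃ N, ∀ v ∈ F, OrientedWalk.level x v < N :=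
      ⟨F.sup (OrientedWalk.level x) + 1, fun v hv => Nat.lt_succ_of_le (Finset.le_sup hv)⟩
    calc _ ≤ ∫⁻ θ, ∫⁻ θ', ∏ n ∈ Finset.range N, (if OrientedWalk.walk hd x n θ' =
          OrientedWalk.walk hd x n θ then ρ else 1)
            ∂OrientedWalk.choiceMeasure ∂OrientedWalk.choiceMeasure :=
          lintegral_mono fun θ => lintegral_mono fun θ' =>
            lintegral_prod_shiftRatio_le hd x hg hpos hρ1 hρ F hN θ θ'
      _ ≤ ∫⁻ _, C ∂OrientedWalk.choiceMeasure := lintegral_mono fun θ => hmeet _ N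
      _ = C := by simp

/-- The perturbed lattice without the point of `x` is absolutely continuous with respect to the
perturbed lattice. -/
theorem measure_configWithout_eq_zero (hd : 3 ≤ d) (x : Fin d → ℤ) {g : (Fin d → ℝ) → ℝ}
    [IsProbabilityMeasure (densityMeasure g)]
    (hac : ((OrientedWalk.choiceMeasure.prod
      (Measure.infinitePi fun _ : Fin d → ℤ => densityMeasure g)).map (slide hd x)) ≪
      Measure.infinitePi fun _ : Fin d → ℤ => densityMeasure g)
    {A : Set (PointConfig (Fin d → ℝ))} (hA : MeasurableSet A)
    (h0 : Measure.infinitePi (fun _ : Fin d → ℤ => densityMeasure g)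
      (perturbedLattice (fun v y => y v) ⁻¹' A) = 0) :
    Measure.infinitePi (fun _ : Fin d → ℤ => densityMeasure g) (configWithout x ⁻¹' A) = 0 := by
  have h1 := hac h0
  rw [Measure.map_apply (measurable_slide hd x) (measurable_perturbedLattice hA)] at h1
  -- After sliding, the configuration no longer depends on the walk.
  have h2 : slide hd x ⁻¹' (perturbedLattice (fun v (y : (Fin d → ℤ) → Fin d → ℝ) => y v) ⁻¹' A) =
      Set.univ ×ˢ (configWithout x ⁻¹' A) := by
    ext p
    simp only [Set.mem_preimage, perturbedLattice_slide, Set.mem_prod, Set.mem_univ, true_and]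
  rw [h2, Measure.prod_prod, measure_univ, one_mul] at h1
  exact h1

end Sliding

/-! ### Deletion tolerance. -/

theorem proposition2p1 (d : ℕ) (hd : 3 ≤ d) :
    ∃ ρ : ℝ, 1 < ρ ∧
      ∀ g : (Fin d → ℝ) → ℝ, Measurable g → (∀ x, 0 < g x) →
        (⨆ i : Fin d, shiftRatioSecondMoment g i) < ENNReal.ofReal ρ →
        ∀ (Ω : Type*) [MeasurableSpace Ω] (P : Measure Ω) [IsProbabilityMeasure P]
          (Y : (Fin d → ℤ) → Ω → (Fin d → ℝ)),
          iIndepFun Y P →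
          (∀ x, HasLaw (Y x) (volume.withDensity fun y => ENNReal.ofReal (g y)) P) →
          DeletionTolerant P (perturbedLattice Y) := by
  obtain ⟨ρ, hρ1, C, hC, hmeet⟩ := OrientedWalk.exists_lintegral_meeting_le
  refine ⟨ρ, hρ1, fun g hg hpos hlt Ω _ P _ Y hind hlaw => ?_⟩
  have hlaw' : ∀ x, HasLaw (Y x) (densityMeasure g) P := hlaw
  have hprob : IsProbabilityMeasure (densityMeasure g) := by
    rw [← (hlaw' 0).map_eq]
    exact Measure.isProbabilityMeasure_map (hlaw' 0).aemeasurable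
  -- Lebesgue measure has no atoms only in positive dimension.
  have : Nonempty (Fin d) := ⟨⟨0, by omega⟩⟩
  have : NullSingletonClass (densityMeasure g) := by
    unfold densityMeasure; infer_instance
  have hY : AEMeasurable (fun ω v => Y v ω) P := aemeasurable_pi_iff.2 fun v => (hlaw' v).aemeasurable
  have hjoint := hind.hasLaw_infinitePi hlaw' hY
  have hPi : AEMeasurable (perturbedLattice Y) P := measurable_perturbedLattice.comp_aemeasurable hY
  have hac : ∀ x, _ := fun x => map_slide_absolutelyContinuous hd x hg hpos
    (ENNReal.one_le_ofReal.2 hρ1.le) (fun i => ((le_iSup _ i).trans_lt hlt).le) hC (hmeet d hd x)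
  refine ⟨hPi, fun Z hZ => ⟨?_, hPi, ?_⟩⟩
  · exact measurable_erase_perturbedLattice.comp_aemeasurable (hY.prodMk hZ.1)
  have hE : AEMeasurable (fun ω => (perturbedLattice Y ω).erase (Z ω)) P :=
    measurable_erase_perturbedLattice.comp_aemeasurable (hY.prodMk hZ.1)
  refine Measure.AbsolutelyContinuous.mk fun A hA h0 => ?_
  rw [Measure.map_apply_of_aemeasurable hPi hA] at h0
  rw [Measure.map_apply_of_aemeasurable hE hA]
  have h0' : Measure.infinitePi (fun _ : Fin d → ℤ => densityMeasure g)
      (perturbedLattice (fun v y => y v) ⁻¹' A) = 0 := by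
    rw [← hjoint.map_eq, Measure.map_apply_of_aemeasurable hY (measurable_perturbedLattice hA)]
    exact h0
  -- One null set serves all labels, so the label of `Z` may depend on `ω` arbitrarily.
  have hx : ∀ᵐ ω ∂P, ∀ x, configWithout x (fun v => Y v ω) ∉ A := by
    rw [ae_all_iff]
    intro x
    have h1 := measure_configWithout_eq_zero hd x (hac x) hA h0'
    rw [← hjoint.map_eq, Measure.map_apply_of_aemeasurable hY (measurable_configWithout x hA)] at h1
    exact measure_eq_zero_iff_ae_notMem.1 h1
  -- Without coincidences, erasing a point is the same as dropping its label.
  have hdist : ∀ᵐ ω ∂P, ∀ v w, v ≠ w → latticePoint v + Y v ω ≠ latticePoint w + Y w ω := by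
    have h1 := ae_ne_of_infinitePi (densityMeasure g) (latticePoint (d := d))
    rw [← hjoint.map_eq] at h1
    exact ae_of_ae_map hY h1
  rw [measure_eq_zero_iff_ae_notMem]
  filter_upwards [hx, hdist, hZ.2] with ω h1 h2 h3 h4
  obtain ⟨x, hx⟩ := h3
  refine h1 x ?_
  have heq : configWithout x (fun v => Y v ω) = (perturbedLattice Y ω).erase (Z ω) := by
    ext z
    change (∃ v, v ≠ x ∧ latticePoint v + Y v ω = z) ↔ (∃ v, latticePoint v + Y v ω = z) ∧ z ≠ Z ω
    constructor
    · rintro ⟨v, hv, rfl⟩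
      refine ⟨⟨v, rfl⟩, ?_⟩
      rw [← hx]
      exact h2 v x hv
    · rintro ⟨⟨v, rfl⟩, hv⟩
      refine ⟨v, ?_, rfl⟩
      rintro rfl
      exact hv hx
  rw [heq]
  exact h4
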